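/- \textbf{Setting.} Terms, considered up to $\alpha$-equivalence, are given by $t ::= x \mid \lambda x.t \mid t\,t \mid t[x\backslash t]$, where the explicit substitution $t[x\backslash u]$ binds $x$ in $t$ (not in $u$). A term is \emph{pure} if it contains no explicit substitution. The unfolding $t^\star$ of a term is the pure term defined by $x^\star=x$, $(\lambda x.t)^\star=\lambda x.t^\star$, $(t\,u)^\star=t^\star\,u^\star$, $(t[x\backslash u])^\star=t^\star\{x:=u^\star\}$ (capture-avoiding substitution). Values are abstractions. In every rule below a bound variable is fresh: it is not in $\varphi$, not in $\rho$, and not free in any term of the rule outside its scope. \emph{Structures.} For a set $\varphi$ of (frozen) variables, $\mathcal S_\varphi$ is inductively defined by: $x\in\mathcal S_\varphi$ if $x\in\varphi$; $t\,u\in\mathcal S_\varphi$ if $t\in\mathcal S_\varphi$; $t[x\backslash u]\in\mathcal S_\varphi$ if $t\in\mathcal S_\varphi$, or if $t\in\mathcal S_{\varphi\cup\{x\}}$ and $u\in\mathcal S_\varphi$. \emph{Reduction.} Let $\rho$ range over $\mathsf{dB}$, $\mathsf{lsv}$, $\mathsf{id}_x$, $\mathsf{sub}_{x\backslash v}$,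 and $\mu$ over $\{\top,\bot\}$. The relations $t\xrightarrow{\rho,\varphi,\mu}t'$, $t\to_{\mathsf{dB}}t'$ and $t\to_{\mathsf{lsv}}^{\varphi,\mu}t'$ are the least ones such that: \begin{itemize} \item $t\,u\xrightarrow{\rho,\varphi,\mu}t'\,u$ if $t\xrightarrow{\rho,\varphi,\bot}t'$; \item $t\,u\xrightarrow{\rho,\varphi,\mu}t\,u'$ if $t\in\mathcal S_\varphi$ and $u\xrightarrow{\rho,\varphi,\top}u'$; \item $\lambda x.t\xrightarrow{\rho,\varphi,\top}\lambda x.t'$ if $t\xrightarrow{\rho,\varphi\cup\{x\},\top}t'$; \item $\lambda x.t\xrightarrow{\rho,\varphi,\bot}\lambda x.t'$ if $t\xrightarrow{\rho,\varphi,\bot}t'$; \item $t[x\backslash u]\xrightarrow{\rho,\varphi,\mu}t'[x\backslash u]$ if $t\xrightarrow{\rho,\varphi,\mu}t'$, or if $t\xrightarrow{\rho,\varphi\cup\{x\},\mu}t'$ and $u\in\mathcal S_\varphi$; \item $t[x\backslash u]\xrightarrow{\rho,\varphi,\mu}t[x\backslash u']$ if $t\xrightarrow{\mathsf{id}_x,\varphi,\mu}t$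 and $u\xrightarrow{\rho,\varphi,\bot}u'$; \item $x\xrightarrow{\mathsf{id}_x,\varphi,\mu}x$ and $x\xrightarrow{\mathsf{sub}_{x\backslash v},\varphi,\mu}v$; \item $t\xrightarrow{\mathsf{dB},\varphi,\mu}t'$ if $t\to_{\mathsf{dB}}t'$; $\;t\xrightarrow{\mathsf{lsv},\varphi,\mu}t'$ if $t\to_{\mathsf{lsv}}^{\varphi,\mu}t'$; \item $(\lambda x.t)\,u\to_{\mathsf{dB}}t[x\backslash u]$; $\;t[x\backslash w]\,u\to_{\mathsf{dB}}z[x\backslash w]$ if $t\,u\to_{\mathsf{dB}}z$; \item $t[x\backslash v]\to_{\mathsf{lsv}}^{\varphi,\mu}t'[x\backslash v]$ if $v$ is a value and $t\xrightarrow{\mathsf{sub}_{x\backslash v},\varphi,\mu}t'$; \item $t[x\backslash u[y\backslash w]]\to_{\mathsf{lsv}}^{\varphi,\mu}t'[y\backslash w]$ if $t[x\backslash u]\to_{\mathsf{lsv}}^{\varphi,\mu}t'$, or if $t[x\backslash u]\to_{\mathsf{lsv}}^{\varphi\cup\{y\},\mu}t'$ and $w\in\mathcal S_\varphi$. \end{itemize}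 The strong call-by-need calculus $\lambda_{\mathsf{sn}}$ has the one-step reduction $t\to_{\mathsf{sn}}t'$, which holds iff $t\xrightarrow{\mathsf{dB},\varphi,\top}t'$ or $t\xrightarrow{\mathsf{lsv},\varphi,\top}t'$ for some $\varphi$ containing all free variables of $t$. \textbf{Theorem (Completeness).} Let $t$ be a pure $\lambda$-term that is weakly normalizing for $\beta$-reduction, i.e. some $\beta$-reduction sequence from $t$ reaches a $\beta$-normal form. Then $t$ is strongly normalizing in $\lambda_{\mathsf{sn}}$: there is no infinite $\to_{\mathsf{sn}}$-reduction sequence from $t$. Moreover, if $n_\beta$ is the $\beta$-normal form of $t$, then every $\lambda_{\mathsf{sn}}$-normal form $n_{\mathsf{sn}}$ of $t$ (that is, $t\to_{\mathsf{sn}}^*n_{\mathsf{sn}}$ and $n_{\mathsf{sn}}\not\to_{\mathsf{sn}}$) satisfies $n_{\mathsf{sn}}^\star=n_\beta$. -/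

import Mathlib

/-! ## Abstract reduction: normal forms, weak and strong normalization -/

/-- `n` is a normal form of `a` for the reduction relation `r`: `a` reduces to `n` in finitely many
steps and no step is possible from `n`. -/
def IsNormalFormOf {α : Type*} (r : α → α → Prop) (a n : α) : Prop :=
  Relation.ReflTransGen r a n ∧ ∀ b, ¬ r n b

/-- Some reduction sequence from `a` reaches a normal form. -/
def WeaklyNormalizing {α : Type*} (r : α → α → Prop) (a : α) : Prop :=
  ∃ n, IsNormalFormOf r a n

/-- There is no infinite reduction sequence from `a` (expressed as accessibility of `a` for the
converse of `r`). -/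
def StronglyNormalizing {α : Type*} (r : α → α → Prop) (a : α) : Prop :=
  Acc (fun x y => r y x) a

/-- Extend a renaming of de Bruijn indices under one binder. -/
def liftRen (f : ℕ → ℕ) : ℕ → ℕ
  | 0 => 0
  | n + 1 => f n + 1

/-! ## The pure λ-calculus, up to α-equivalence (de Bruijn indices) -/

/-- Pure λ-terms. The index `n` at depth `d` is bound if `n < d`, and otherwise stands for the free
variable number `n - d`. -/
inductive Lam : Type
  | var : ℕ → Lam
  | lam : Lam → Lam
  | app : Lam → Lam → Lam

namespace Lam

def rename : (ℕ → ℕ) → Lam → Lam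
  | f, var n => var (f n)
  | f, lam t => lam (rename (liftRen f) t)
  | f, app t u => app (rename f t) (rename f u)

/-- Extend a substitution under one binder. -/
def liftSub (σ : ℕ → Lam) : ℕ → Lam
  | 0 => var 0
  | n + 1 => (σ n).rename Nat.succ

/-- Simultaneous capture-avoiding substitution. -/
def subst : (ℕ → Lam) → Lam → Lam
  | σ, var n => σ n
  | σ, lam t => lam (subst (liftSub σ) t)
  | σ, app t u => app (subst σ t) (subst σ u)

/-- The substitution replacing variable `0` by `u` and lowering the other variables by one. -/
def single (u : Lam) : ℕ → Lam
  | 0 => u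
  | n + 1 => var n

/-- `t{x := u}`, where `x` is the variable `0` of `t`. -/
def inst (t u : Lam) : Lam := t.subst (single u)

/-- One step of β-reduction, in any context. -/
inductive Beta : Lam → Lam → Prop
  | beta (t u : Lam) : Beta (app (lam t) u) (t.inst u)
  | lam {t t' : Lam} : Beta t t' → Beta (lam t) (lam t')
  | appLeft {t t' : Lam} (u : Lam) : Beta t t' → Beta (app t u) (app t' u)
  | appRight (t : Lam) {u u' : Lam} : Beta u u' → Beta (app t u) (app t u')

end Lam

/-! ## Terms with explicit substitutions -/

/-- λ-terms with explicit substitutions, up to α-equivalence. In `es t u`, which is `t[x\u]`, the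
variable `x` is the index `0` of `t`; it is not bound in `u`. -/
inductive Term : Type
  | var : ℕ → Term
  | lam : Term → Term
  | app : Term → Term → Term
  | es : Term → Term → Term

/-- A pure λ-term, seen as a term that contains no explicit substitution. -/
def Lam.toTerm : Lam → Term
  | .var n => .var n
  | .lam t => .lam t.toTerm
  | .app t u => .app t.toTerm u.toTerm

namespace Term

def rename : (ℕ → ℕ) → Term → Term
  | f, var n => var (f n)
  | f, lam t => lam (rename (liftRen f) t)
  | f, app t u => app (rename f t) (rename f u)
  | f, es t u => es (rename (liftRen f) t) (rename f u)

/-- The term `t`, placed under one more binder, whose variable is fresh for `t`. -/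
def shift (t : Term) : Term := t.rename Nat.succ

/-- The set of free variables. -/
def fv : Term → Set ℕ
  | var n => {n}
  | lam t => {n | n + 1 ∈ fv t}
  | app t u => fv t ∪ fv u
  | es t u => {n | n + 1 ∈ fv t} ∪ fv u

/-- The unfolding of a term, which performs all its explicit substitutions. -/
def unfold : Term → Lam
  | var n => .var n
  | lam t => .lam t.unfold
  | app t u => .app t.unfold u.unfold
  | es t u => t.unfold.inst u.unfold

/-- The values are the abstractions. -/
inductive IsValue : Term → Prop
  | lam (t : Term) : IsValue (lam t)

end Term

/-! ## The strong call-by-need calculus -/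

/-- The set `φ` seen under a binder whose variable is not frozen. -/
def underBinder (φ : Set ℕ) : Set ℕ := Nat.succ '' φ

/-- The set `φ ∪ {x}` seen under the binder of `x`. -/
def underFrozen (φ : Set ℕ) : Set ℕ := insert 0 (Nat.succ '' φ)

open Term

/-- `Struct φ t`: the term `t` is a structure under the set `φ` of frozen variables. -/
inductive Struct : Set ℕ → Term → Prop
  | var {φ : Set ℕ} {x : ℕ} : x ∈ φ → Struct φ (var x)
  | app {φ : Set ℕ} {t : Term} (u : Term) : Struct φ t → Struct φ (app t u)
  | es {φ : Set ℕ} {t : Term} (u : Term) : Struct (underBinder φ) t → Struct φ (es t u)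
  | esStruct {φ : Set ℕ} {t u : Term} :
      Struct (underFrozen φ) t → Struct φ u → Struct φ (es t u)

/-- The reduction rules `ρ` that label the inductive reduction relation: the two actual rules dB and
lsv, and the two auxiliary rules `id x` (probe for an occurrence of the variable `x`) and `sub x v`
(replace one occurrence of the variable `x` by `v`). -/
inductive Rule : Type
  | dB : Rule
  | lsv : Rule
  | id : ℕ → Rule
  | sub : ℕ → Term → Rule

/-- The rule `ρ` seen under a binder whose variable is fresh for `ρ`. -/
def Rule.shift : Rule → Rule
  | .dB => .dB
  | .lsv => .lsv
  | .id x => .id (x + 1)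
  | .sub x v => .sub (x + 1) v.shift

/-- The flag `μ`: top-level-like positions (`top`) and other positions (`bot`). -/
inductive PosFlag : Type
  | top : PosFlag
  | bot : PosFlag

/-- dB-reduction at the root: `(λx.t)L u → t[x\u]L`, with `L` a list of explicit substitutions. -/
inductive AuxDB : Term → Term → Prop
  | base (t u : Term) : AuxDB (app (lam t) u) (es t u)
  | sigma {t u z : Term} (w : Term) :
      AuxDB (app t u.shift) z → AuxDB (app (es t w) u) (es z w)

mutual

/-- `Step ρ φ μ t t'`: the term `t`, at a position with frozen variables `φ` and flag `μ`, reduces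
to `t'` by the rule `ρ`. -/
inductive Step : Rule → Set ℕ → PosFlag → Term → Term → Prop
  | appLeft {ρ : Rule} {φ : Set ℕ} {μ : PosFlag} {t t' : Term} (u : Term) :
      Step ρ φ .bot t t' → Step ρ φ μ (app t u) (app t' u)
  | appRight {ρ : Rule} {φ : Set ℕ} {μ : PosFlag} {t u u' : Term} :
      Struct φ t → Step ρ φ .top u u' → Step ρ φ μ (app t u) (app t u')
  | absTop {ρ : Rule} {φ : Set ℕ} {t t' : Term} :
      Step ρ.shift (underFrozen φ) .top t t' → Step ρ φ .top (lam t) (lam t')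
  | absBot {ρ : Rule} {φ : Set ℕ} {t t' : Term} :
      Step ρ.shift (underBinder φ) .bot t t' → Step ρ φ .bot (lam t) (lam t')
  | esLeft {ρ : Rule} {φ : Set ℕ} {μ : PosFlag} {t t' : Term} (u : Term) :
      Step ρ.shift (underBinder φ) μ t t' → Step ρ φ μ (es t u) (es t' u)
  | esLeftStruct {ρ : Rule} {φ : Set ℕ} {μ : PosFlag} {t t' u : Term} :
      Step ρ.shift (underFrozen φ) μ t t' → Struct φ u → Step ρ φ μ (es t u) (es t' u)
  | esRight {ρ : Rule} {φ : Set ℕ} {μ : PosFlag} {t u u' : Term} :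
      Step (.id 0) (underBinder φ) μ t t → Step ρ φ .bot u u' → Step ρ φ μ (es t u) (es t u')
  | id (φ : Set ℕ) (μ : PosFlag) (x : ℕ) : Step (.id x) φ μ (var x) (var x)
  | sub (φ : Set ℕ) (μ : PosFlag) (x : ℕ) (v : Term) : Step (.sub x v) φ μ (var x) v
  | dB {φ : Set ℕ} {μ : PosFlag} {t t' : Term} : AuxDB t t' → Step .dB φ μ t t'
  | lsv {φ : Set ℕ} {μ : PosFlag} {t t' : Term} : AuxLSV φ μ t t' → Step .lsv φ μ t t'

/-- lsv-reduction at the root, in a position with frozen variables `φ` and flag `μ`: in a term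
`t[x\vL]`, one reachable occurrence of `x` in `t` is replaced by the value `v`, and the list `L` of
explicit substitutions is moved outwards. In the rules `sigma` and `sigmaStruct`, the term `t`, whose
variable `0` is `x`, is moved into the scope of the binder of `y`, which is fresh for `t`. -/
inductive AuxLSV : Set ℕ → PosFlag → Term → Term → Prop
  | base {φ : Set ℕ} {μ : PosFlag} {t t' v : Term} :
      Step (.sub 0 v.shift) (underBinder φ) μ t t' → IsValue v →
      AuxLSV φ μ (es t v) (es t' v)
  | sigma {φ : Set ℕ} {μ : PosFlag} {t u t' : Term} (w : Term) :
      AuxLSV (underBinder φ) μ (es (t.rename (liftRen Nat.succ)) u) t' →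
      AuxLSV φ μ (es t (es u w)) (es t' w)
  | sigmaStruct {φ : Set ℕ} {μ : PosFlag} {t u t' w : Term} :
      AuxLSV (underFrozen φ) μ (es (t.rename (liftRen Nat.succ)) u) t' → Struct φ w →
      AuxLSV φ μ (es t (es u w)) (es t' w)

end

/-- One step of reduction in the strong call-by-need calculus: a step by rule dB or lsv at top level,
where the free variables of the term are frozen. (Freezing variables that do not occur free in the
term makes no difference.) -/
def SnRed (t t' : Term) : Prop :=
  ∃ φ : Set ℕ, t.fv ⊆ φ ∧ (Step .dB φ .top t t' ∨ Step .lsv φ .top t t')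

/-!
Strong normalization is obtained from a system of non-idempotent intersection types. A judgement
`Typ t τ a` records in the usage `a` both the typing context and the size of the derivation. An
argument is typed once for each type that its function demands, possibly never, so a step need not
decrease the size unless it happens in a typed position. The predicates `Ty.Pos` and `Ty.Neg`
exclude arrows with an empty domain at one polarity, and this makes every position that the
strategy reaches a typed one: when the frozen variables have types in `Ty.Neg`, so do structures
(`Struct.neg`), hence the arguments of structures are typed, at types in `Ty.Pos`; and the probe
`id x` finds a typed occurrence of `x`, hence `u` is typed in `t[x\u]` when the calculus evaluates
it. Consequently every step keeps the type and the context and makes the derivation smaller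
(`Step.effect`): rule dB removes an application and an abstraction, and rule lsv moves derivations
of the value to the places of the axioms that they replace. Normal forms have a suitable typing
(`Lam.exists_typ_of_normal`), and typability is preserved by β-expansion
(`Lam.Beta.typ_expansion`), so weakly normalizing pure terms are typable, and thus strongly
normalizing in the calculus.

For the normal forms, each step of the calculus is a parallel β-step between the unfoldings
(`SnRed.par_unfold`), and the unfolding of an irreducible term is β-normal
(`SnRed.unfold_normal`), because a term that has no step and no reachable occurrence of an
unfrozen variable is an answer or a structure, or unfolds to a normal form (`Term.progress`). By
confluence of parallel reduction, this normal form is the one reached by β-reduction.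
-/

/-! ### Substitution in pure terms -/

namespace Lam

/-- The substitution that sends variable `0` to `u` and variable `n + 1` to `σ n`. -/
def scons (u : Lam) (σ : ℕ → Lam) : ℕ → Lam
  | 0 => u
  | n + 1 => σ n

theorem liftSub_var : liftSub var = var := by
  funext n; cases n <;> rfl

theorem liftRen_comp (f g : ℕ → ℕ) : liftRen g ∘ liftRen f = liftRen (g ∘ f) := by
  funext n; cases n <;> rfl

theorem liftSub_comp_liftRen (σ : ℕ → Lam) (f : ℕ → ℕ) :
    liftSub σ ∘ liftRen f = liftSub (σ ∘ f) := by
  funext n; cases n <;> rfl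

theorem subst_var (t : Lam) : t.subst var = t := by
  induction t <;> simp_all [subst, liftSub_var]

theorem rename_rename (t : Lam) (f g : ℕ → ℕ) : (t.rename f).rename g = t.rename (g ∘ f) := by
  induction t generalizing f g <;> simp_all [rename, liftRen_comp]

theorem subst_rename (t : Lam) (f : ℕ → ℕ) (σ : ℕ → Lam) :
    (t.rename f).subst σ = t.subst (σ ∘ f) := by
  induction t generalizing f σ <;> simp_all [rename, subst, liftSub_comp_liftRen]

theorem rename_liftSub (σ : ℕ → Lam) (f : ℕ → ℕ) :
    (fun n => (liftSub σ n).rename (liftRen f)) = liftSub fun n => (σ n).rename f := by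
  funext n
  cases n with
  | zero => rfl
  | succ n => simp only [liftSub, rename_rename]; rfl

theorem rename_subst (t : Lam) (σ : ℕ → Lam) (f : ℕ → ℕ) :
    (t.subst σ).rename f = t.subst fun n => (σ n).rename f := by
  induction t generalizing f σ <;> simp_all [rename, subst, rename_liftSub]

theorem subst_liftSub (σ τ : ℕ → Lam) :
    (fun n => (liftSub σ n).subst (liftSub τ)) = liftSub fun n => (σ n).subst τ := by
  funext n
  cases n with
  | zero => rfl
  | succ n => simp only [liftSub, rename_subst, subst_rename]; rfl

theorem subst_subst (t : Lam) (σ τ : ℕ → Lam) :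
    (t.subst σ).subst τ = t.subst fun n => (σ n).subst τ := by
  induction t generalizing σ τ <;> simp_all [subst, subst_liftSub]

theorem inst_subst (t u : Lam) (σ : ℕ → Lam) :
    (t.inst u).subst σ = t.subst (scons (u.subst σ) σ) := by
  rw [inst, subst_subst]
  congr 1; funext n; cases n <;> rfl

theorem subst_liftSub_inst (t u : Lam) (σ : ℕ → Lam) :
    (t.subst (liftSub σ)).inst u = t.subst (scons u σ) := by
  rw [inst, subst_subst]
  congr 1; funext n
  cases n with
  | zero => rfl
  | succ n => simp only [liftSub, subst_rename]; exact subst_var _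

theorem rename_succ_subst_scons (t u : Lam) (σ : ℕ → Lam) :
    (t.rename Nat.succ).subst (scons u σ) = t.subst σ :=
  subst_rename ..

theorem inst_rename (t u : Lam) (f : ℕ → ℕ) :
    (t.inst u).rename f = (t.rename (liftRen f)).inst (u.rename f) := by
  rw [inst, inst, rename_subst, subst_rename]
  congr 1; funext n; cases n <;> rfl

/-! ### Parallel β-reduction and uniqueness of normal forms -/

/-- Parallel β-reduction: any set of β-redexes present in the term is contracted at once. -/
inductive Par : Lam → Lam → Prop
  | var (n : ℕ) : Par (var n) (var n)
  | lam {t t' : Lam} : Par t t' → Par (lam t) (lam t')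
  | app {t t' u u' : Lam} : Par t t' → Par u u' → Par (app t u) (app t' u')
  | beta {t t' u u' : Lam} : Par t t' → Par u u' → Par (app (lam t) u) (t'.inst u')

theorem Par.refl : ∀ t : Lam, Par t t
  | .var n => .var n
  | .lam t => .lam (Par.refl t)
  | .app t u => .app (Par.refl t) (Par.refl u)

theorem Par.rename {t t' : Lam} (h : Par t t') (f : ℕ → ℕ) : Par (t.rename f) (t'.rename f) := by
  induction h generalizing f with
  | var n => exact .var _
  | lam _ ih => exact .lam (ih _)
  | app _ _ ih₁ ih₂ => exact .app (ih₁ _) (ih₂ _)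
  | beta _ _ ih₁ ih₂ => rw [inst_rename]; exact .beta (ih₁ _) (ih₂ _)

theorem Par.liftSub {σ σ' : ℕ → Lam} (h : ∀ n, Par (σ n) (σ' n)) (n : ℕ) :
    Par (liftSub σ n) (liftSub σ' n) := by
  cases n with
  | zero => exact .var 0
  | succ n => exact (h n).rename _

theorem Par.subst {t t' : Lam} (h : Par t t') {σ σ' : ℕ → Lam} (hσ : ∀ n, Par (σ n) (σ' n)) :
    Par (t.subst σ) (t'.subst σ') := by
  induction h generalizing σ σ' with
  | var n => exact hσ n
  | lam _ ih => exact .lam (ih (Par.liftSub hσ))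
  | app _ _ ih₁ ih₂ => exact .app (ih₁ hσ) (ih₂ hσ)
  | beta _ _ ih₁ ih₂ =>
    rw [inst_subst, ← subst_liftSub_inst]
    exact .beta (ih₁ (Par.liftSub hσ)) (ih₂ hσ)

theorem Par.inst {t t' u u' : Lam} (ht : Par t t') (hu : Par u u') :
    Par (t.inst u) (t'.inst u') := by
  refine ht.subst fun n => ?_
  cases n with
  | zero => exact hu
  | succ n => exact .var n

/-- The complete development of a term: all its β-redexes are contracted at once. -/
def dev : Lam → Lam
  | var n => var n
  | lam t => lam (dev t)
  | app (lam t) u => (dev t).inst (dev u)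
  | app t u => app (dev t) (dev u)

/-- Takahashi's triangle property, from which the diamond property follows. -/
theorem Par.dev {t t' : Lam} (h : Par t t') : Par t' t.dev := by
  induction h with
  | var n => exact .var n
  | lam _ ih => exact .lam ih
  | @app t t' u u' h _ ih₁ ih₂ =>
    cases t with
    | var n => exact .app ih₁ ih₂
    | app _ _ => exact .app ih₁ ih₂
    | lam s =>
      cases h with
      | lam _ =>
        cases ih₁ with
        | lam h => exact .beta h ih₂
  | beta _ _ ih₁ ih₂ => exact ih₁.inst ih₂

theorem Beta.par {t t' : Lam} (h : Beta t t') : Par t t' := by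
  induction h with
  | beta t u => exact .beta (.refl t) (.refl u)
  | lam _ ih => exact .lam ih
  | appLeft u _ ih => exact .app ih (.refl u)
  | appRight t _ ih => exact .app (.refl t) ih

theorem Par.eq_of_normal {t t' : Lam} (h : Par t t') (hn : ∀ b, ¬ Beta t b) : t' = t := by
  induction h with
  | var n => rfl
  | lam _ ih => rw [ih fun b hb => hn _ hb.lam]
  | app _ _ ih₁ ih₂ =>
    rw [ih₁ fun b hb => hn _ (hb.appLeft _), ih₂ fun b hb => hn _ (hb.appRight _)]
  | beta _ _ _ _ => exact absurd (.beta _ _) (hn _)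

theorem Par.eq_of_normal_of_reflTransGen {t t' : Lam} (h : Relation.ReflTransGen Par t t')
    (hn : ∀ b, ¬ Beta t b) : t' = t := by
  induction h with
  | refl => rfl
  | tail _ h ih => subst ih; exact h.eq_of_normal hn

theorem eq_of_par_normal {t a b : Lam} (ha : Relation.ReflTransGen Par t a)
    (hb : Relation.ReflTransGen Par t b) (hna : ∀ c, ¬ Beta a c) (hnb : ∀ c, ¬ Beta b c) :
    a = b := by
  obtain ⟨d, had, hbd⟩ := Relation.church_rosser
    (fun a b c hab hac => ⟨a.dev, .single hab.dev, .single hac.dev⟩) ha hb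
  rw [← Par.eq_of_normal_of_reflTransGen had hna, ← Par.eq_of_normal_of_reflTransGen hbd hnb]

end Lam

/-! ### Reduction steps, seen through unfolding -/

theorem Lam.unfold_toTerm (t : Lam) : t.toTerm.unfold = t := by
  induction t <;> simp_all [Lam.toTerm, Term.unfold]

theorem Lam.toTerm_rename (t : Lam) (f : ℕ → ℕ) : (t.rename f).toTerm = t.toTerm.rename f := by
  induction t generalizing f <;> simp_all [Lam.toTerm, Term.rename, Lam.rename]

namespace Term

theorem unfold_rename (t : Term) (f : ℕ → ℕ) : (t.rename f).unfold = t.unfold.rename f := by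
  induction t generalizing f <;> simp_all [unfold, rename, Lam.rename, Lam.inst_rename]

theorem unfold_shift (t : Term) : t.shift.unfold = t.unfold.rename Nat.succ :=
  unfold_rename ..

end Term

/-- Moving a substitution `[y\w]` out of the substituted term in `t[x\u[y\w]]` does not change the
unfolding. -/
theorem Lam.inst_inst (t u w : Lam) :
    t.inst (u.inst w) = ((t.rename (liftRen Nat.succ)).inst u).inst w := by
  rw [Lam.inst, Lam.inst, Lam.inst, Lam.inst, Lam.subst_subst, Lam.subst_rename]
  congr 1; funext n; cases n <;> rfl

theorem Lam.rename_succ_inst (t u : Lam) : (t.rename Nat.succ).inst u = t := by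
  rw [Lam.inst, Lam.subst_rename]; exact Lam.subst_var t

theorem AuxDB.par_unfold {t t' : Term} (h : AuxDB t t') : Lam.Par t.unfold t'.unfold := by
  induction h with
  | base t u => exact .beta (.refl _) (.refl _)
  | @sigma t u z w _ ih =>
    have ih := ih.inst (.refl w.unfold)
    have hu := Lam.rename_succ_inst u.unfold w.unfold
    rw [← Term.unfold_shift] at hu
    change Lam.Par (.app (t.unfold.inst w.unfold) (u.shift.unfold.inst w.unfold)) _ at ih
    rwa [hu] at ih

/-- What a step labelled by `ρ` does to unfoldings: rules dB and lsv contract a set of β-redexes,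
empty for lsv, in parallel, and `sub x v` is invisible to every substitution that already
identifies `x` with `v`. -/
def Rule.UnfoldRel : Rule → Lam → Lam → Prop
  | .dB, a, b => Lam.Par a b
  | .lsv, a, b => Lam.Par a b
  | .id _, _, _ => True
  | .sub x v, a, b => ∀ σ : ℕ → Lam, σ x = v.unfold.subst σ → a.subst σ = b.subst σ

namespace Rule.UnfoldRel

theorem appLeft {ρ : Rule} {a b : Lam} (c : Lam) (h : ρ.UnfoldRel a b) :
    ρ.UnfoldRel (.app a c) (.app b c) := by
  cases ρ with
  | dB => exact .app h (.refl c)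
  | lsv => exact .app h (.refl c)
  | id x => trivial
  | sub x v => intro σ hσ; simp only [Lam.subst, h σ hσ]

theorem appRight {ρ : Rule} {a b : Lam} (c : Lam) (h : ρ.UnfoldRel a b) :
    ρ.UnfoldRel (.app c a) (.app c b) := by
  cases ρ with
  | dB => exact .app (.refl c) h
  | lsv => exact .app (.refl c) h
  | id x => trivial
  | sub x v => intro σ hσ; simp only [Lam.subst, h σ hσ]

theorem lam {ρ : Rule} {a b : Lam} (h : ρ.shift.UnfoldRel a b) :
    ρ.UnfoldRel (.lam a) (.lam b) := by
  cases ρ with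
  | dB => exact Lam.Par.lam h
  | lsv => exact Lam.Par.lam h
  | id x => trivial
  | sub x v =>
    intro σ hσ
    refine congrArg Lam.lam (h _ ?_)
    simp only [Term.unfold_shift, Lam.liftSub, hσ, Lam.rename_subst, Lam.subst_rename]
    rfl

theorem instLeft {ρ : Rule} {a b : Lam} (c : Lam) (h : ρ.shift.UnfoldRel a b) :
    ρ.UnfoldRel (a.inst c) (b.inst c) := by
  cases ρ with
  | dB => exact h.inst (.refl c)
  | lsv => exact h.inst (.refl c)
  | id x => trivial
  | sub x v =>
    intro σ hσ
    simp only [Lam.inst_subst]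
    refine h _ ?_
    rw [Term.unfold_shift, Lam.rename_succ_subst_scons]
    exact hσ

theorem instRight {ρ : Rule} {a b : Lam} (c : Lam) (h : ρ.UnfoldRel a b) :
    ρ.UnfoldRel (c.inst a) (c.inst b) := by
  cases ρ with
  | dB => exact .inst (.refl c) h
  | lsv => exact .inst (.refl c) h
  | id x => trivial
  | sub x v => intro σ hσ; simp only [Lam.inst_subst, h σ hσ]

end Rule.UnfoldRel

mutual

theorem Step.unfoldRel {ρ : Rule} {φ : Set ℕ} {μ : PosFlag} {t t' : Term} :
    Step ρ φ μ t t' → ρ.UnfoldRel t.unfold t'.unfold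
  | .appLeft _ h => h.unfoldRel.appLeft _
  | .appRight _ h => h.unfoldRel.appRight _
  | .absTop h => h.unfoldRel.lam
  | .absBot h => h.unfoldRel.lam
  | .esLeft _ h => h.unfoldRel.instLeft _
  | .esLeftStruct h _ => h.unfoldRel.instLeft _
  | .esRight _ h => h.unfoldRel.instRight _
  | .id _ _ _ => trivial
  | .sub _ _ _ _ => fun _ hσ => hσ
  | .dB h => h.par_unfold
  | .lsv h => by
    rw [Rule.UnfoldRel, h.unfold_eq]
    exact .refl _

theorem AuxLSV.unfold_eq {φ : Set ℕ} {μ : PosFlag} {t t' : Term} :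
    AuxLSV φ μ t t' → t.unfold = t'.unfold
  | .base h _ => h.unfoldRel _ (by
      rw [Term.unfold_shift]; exact (Lam.rename_succ_inst _ _).symm)
  | .sigma w h => by
    have := h.unfold_eq
    simp only [Term.unfold, Term.unfold_rename] at this ⊢
    rw [Lam.inst_inst, this]
  | .sigmaStruct h _ => by
    have := h.unfold_eq
    simp only [Term.unfold, Term.unfold_rename] at this ⊢
    rw [Lam.inst_inst, this]

end

theorem SnRed.par_unfold {t t' : Term} (h : SnRed t t') : Lam.Par t.unfold t'.unfold := by
  obtain ⟨φ, -, h | h⟩ := h <;> exact h.unfoldRel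

/-! ### Non-idempotent intersection types -/

/-- The types of a non-idempotent intersection type system. The only types needed are a base type
and arrows `M → τ` whose domain `M` is a finite multiset of types, so any type with an injection of
pairs `(M, τ)` will do; they are coded as natural numbers here. -/
def Ty : Type := ℕ

namespace Ty

/-- The base type. -/
def base : Ty := (0 : ℕ)

/-- The arrow type `M → τ`. -/
def arr (M : Multiset Ty) (τ : Ty) : Ty :=
  (Encodable.encode (α := Multiset ℕ × ℕ) (M, τ) + 1 : ℕ)

theorem arr_inj {M N : Multiset Ty} {σ τ : Ty} (h : arr M σ = arr N τ) : M = N ∧ σ = τ :=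
  Prod.mk.inj (Encodable.encode_injective (α := Multiset ℕ × ℕ) (Nat.succ.inj h))

theorem arr_ne_base (M : Multiset Ty) (τ : Ty) : arr M τ ≠ base := Nat.succ_ne_zero _

mutual

/-- Types all of whose negative arrows have a nonempty domain. A term of such a type, in a
context of types satisfying `Ty.Neg`, is typed at every position that a full reduction reaches. -/
inductive Pos : Ty → Prop
  | base : Pos base
  | arr {M : Multiset Ty} {τ : Ty} : (∀ σ ∈ M, Neg σ) → Pos τ → Pos (arr M τ)

/-- Types all of whose positive arrows have a nonempty domain: a function of such a type never
discards its argument unseen. -/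
inductive Neg : Ty → Prop
  | base : Neg base
  | arr {M : Multiset Ty} {τ : Ty} : M ≠ 0 → (∀ σ ∈ M, Pos σ) → Neg τ → Neg (arr M τ)

end

theorem Pos.of_arr {M : Multiset Ty} {τ : Ty} (h : Pos (Ty.arr M τ)) :
    (∀ σ ∈ M, Neg σ) ∧ Pos τ := by
  generalize hρ : Ty.arr M τ = ρ at h
  cases h with
  | base => exact absurd hρ (arr_ne_base _ _)
  | arr h₁ h₂ => obtain ⟨rfl, rfl⟩ := arr_inj hρ; exact ⟨h₁, h₂⟩

theorem Neg.of_arr {M : Multiset Ty} {τ : Ty} (h : Neg (Ty.arr M τ)) :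
    M ≠ 0 ∧ (∀ σ ∈ M, Pos σ) ∧ Neg τ := by
  generalize hρ : Ty.arr M τ = ρ at h
  cases h with
  | base => exact absurd hρ (arr_ne_base _ _)
  | arr h₁ h₂ h₃ => obtain ⟨rfl, rfl⟩ := arr_inj hρ; exact ⟨h₁, h₂, h₃⟩

end Ty

/-- A typing context together with the size of a typing derivation. The context is the multiset of
all pairs `(x, τ)` such that the derivation has an axiom giving the type `τ` to the free variable
`x`. Contexts and sizes are both added when derivations are put together. -/
abbrev Usage : Type := Multiset (ℕ × Ty) × ℕ

namespace Usage

/-- The usage of `card M` axioms, which give the types in `M` to the variable `x`. -/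
def occ (x : ℕ) (M : Multiset Ty) : Usage := (M.map (Prod.mk x), M.card)

/-- The renaming of the variables of a usage. -/
def ren (f : ℕ → ℕ) : Usage →+ Usage :=
  (Multiset.mapAddMonoidHom (Prod.map f id)).prodMap (AddMonoidHom.id ℕ)

/-- The usage `a` placed under a binder, with the types in `M` for the bound variable. -/
def bind (M : Multiset Ty) (a : Usage) : Usage := (M.map (Prod.mk 0), 0) + ren Nat.succ a

theorem bind_add (M N : Multiset Ty) (a b : Usage) :
    bind (M + N) (a + b) = bind M a + bind N b := by
  have : ((Multiset.map (Prod.mk 0) (M + N), 0) : Usage)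
      = (Multiset.map (Prod.mk 0) M, 0) + (Multiset.map (Prod.mk 0) N, 0) := by simp
  rw [bind, bind, bind, map_add, this]
  exact add_add_add_comm ..

theorem bind_zero (a : Usage) : bind 0 a = ren Nat.succ a := zero_add _

theorem ren_add_size (f : ℕ → ℕ) (a : Usage) (n : ℕ) : ren f (a + (0, n)) = ren f a + (0, n) := by
  rw [map_add]; simp [ren]

theorem occ_add (x : ℕ) (M N : Multiset Ty) : occ x (M + N) = occ x M + occ x N := by
  simp [occ]

theorem bind_add_occ (M N : Multiset Ty) (a : Usage) (x : ℕ) :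
    bind M (a + occ x N) = bind M a + occ (x + 1) N := by
  have : ren Nat.succ (occ x N) = occ (x + 1) N := by
    simp [ren, occ]
  rw [bind, bind, map_add, this, add_assoc]

theorem bind_add_size (M : Multiset Ty) (a : Usage) (n : ℕ) :
    bind M (a + (0, n)) = bind M a + (0, n) := by
  rw [bind, bind, ren_add_size, add_assoc]

theorem bind_add_occ_zero (M N : Multiset Ty) (a : Usage) :
    bind M a + occ 0 N = bind (M + N) (a + (0, N.card)) := by
  rw [bind_add_size]
  ext1 <;> simp [bind, occ, add_assoc, add_comm (ren Nat.succ a).1]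

/-- The types that a context gives to the variable `0`. -/
def hd (Γ : Multiset (ℕ × Ty)) : Multiset Ty :=
  Γ.filterMap fun | (0, τ) => some τ | (_ + 1, _) => none

/-- A context without its types for the variable `0`, seen from outside of its binder. -/
def tl (Γ : Multiset (ℕ × Ty)) : Multiset (ℕ × Ty) :=
  Γ.filterMap fun | (0, _) => none | (x + 1, τ) => some (x, τ)

theorem hd_bind (M : Multiset Ty) (a : Usage) : hd (bind M a).1 = M := by
  have h₁ : hd (M.map (Prod.mk 0)) = M := by
    rw [hd, Multiset.filterMap_map]; exact Multiset.filterMap_some M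
  have h₂ : hd (ren Nat.succ a).1 = 0 := by
    change hd (a.1.map _) = 0
    rw [hd, Multiset.filterMap_map]
    exact Multiset.eq_zero_of_forall_notMem fun σ hσ => by
      simp [Multiset.mem_filterMap] at hσ
  rw [hd] at h₁ h₂ ⊢
  rw [bind, Prod.fst_add, Multiset.filterMap_add, h₁, h₂, add_zero]

theorem tl_bind (M : Multiset Ty) (a : Usage) : tl (bind M a).1 = a.1 := by
  have h₁ : tl (M.map (Prod.mk 0)) = 0 := by
    rw [tl, Multiset.filterMap_map]
    exact Multiset.eq_zero_of_forall_notMem fun σ hσ => by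
      simp [Multiset.mem_filterMap] at hσ
  have h₂ : tl (ren Nat.succ a).1 = a.1 := by
    change tl (a.1.map _) = a.1
    rw [tl, Multiset.filterMap_map]
    exact Multiset.filterMap_some a.1
  rw [tl] at h₁ h₂ ⊢
  rw [bind, Prod.fst_add, Multiset.filterMap_add, h₁, h₂, zero_add]

theorem bind_fst_inj {M N : Multiset Ty} {a b : Usage} (h : (bind M a).1 = (bind N b).1) :
    M = N ∧ a.1 = b.1 :=
  ⟨by rw [← hd_bind M a, h, hd_bind], by rw [← tl_bind M a, h, tl_bind]⟩

theorem bind_snd (M : Multiset Ty) (a : Usage) : (bind M a).2 = a.2 := by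
  simp [bind, ren]

theorem bind_inj {M N : Multiset Ty} {a b : Usage} (h : bind M a = bind N b) :
    M = N ∧ a = b := by
  obtain ⟨h₁, h₂⟩ := bind_fst_inj (congrArg Prod.fst h)
  exact ⟨h₁, Prod.ext h₂ (by rw [← bind_snd M a, h, bind_snd])⟩

theorem exists_eq_bind (a : Usage) : ∃ M b, a = bind M b := by
  obtain ⟨Γ, n⟩ := a
  induction Γ using Multiset.induction_on with
  | empty => exact ⟨0, (0, n), by simp [bind, ren]⟩
  | cons p Γ ih =>
    obtain ⟨M, b, h⟩ := ih
    have h₁ := congrArg Prod.fst h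
    have h₂ := congrArg Prod.snd h
    rw [bind_snd] at h₂
    dsimp only at h₁ h₂
    obtain ⟨x | x, τ⟩ := p
    · refine ⟨τ ::ₘ M, b, Prod.ext ?_ (by rw [bind_snd, h₂])⟩
      simp [h₁, bind]
    · refine ⟨M, ((x, τ) ::ₘ b.1, b.2), Prod.ext ?_ (by rw [bind_snd, h₂])⟩
      simp [h₁, bind, ren]

theorem mem_bind {M : Multiset Ty} {a : Usage} {p : ℕ × Ty} :
    p ∈ (bind M a).1 ↔ (p.1 = 0 ∧ p.2 ∈ M) ∨ ∃ x, p.1 = x + 1 ∧ (x, p.2) ∈ a.1 := by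
  obtain ⟨x, τ⟩ := p
  cases x <;> simp [bind, ren]

theorem ren_liftRen_bind (f : ℕ → ℕ) (M : Multiset Ty) (a : Usage) :
    ren (liftRen f) (bind M a) = bind M (ren f a) := by
  ext1
  · simp only [bind, ren, AddMonoidHom.coe_prodMap, Multiset.coe_mapAddMonoidHom,
      AddMonoidHom.coe_id, Prod.map_fst, Prod.fst_add, Multiset.map_add, Multiset.map_map]
    rfl
  · simp [bind, ren]

/-- All the types that the context gives to variables in `φ` satisfy `Ty.Neg`. -/
def Good (φ : Set ℕ) (a : Usage) : Prop := ∀ p ∈ a.1, p.1 ∈ φ → Ty.Neg p.2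

theorem good_add {φ : Set ℕ} {a b : Usage} : Good φ (a + b) ↔ Good φ a ∧ Good φ b := by
  simp only [Good, Prod.fst_add, Multiset.mem_add, or_imp, forall_and]

theorem Good.underBinder {φ : Set ℕ} {M : Multiset Ty} {a : Usage} (h : Good φ a) :
    Good (underBinder φ) (bind M a) := by
  rintro ⟨x, τ⟩ hp ⟨y, hy, rfl⟩
  rcases mem_bind.1 hp with ⟨h0, -⟩ | ⟨z, hz, hp⟩
  · exact absurd h0 (Nat.succ_ne_zero _)
  · obtain rfl : y = z := Nat.succ.inj hz
    exact h (y, τ) hp hy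

theorem Good.underFrozen {φ : Set ℕ} {M : Multiset Ty} {a : Usage} (h : Good φ a)
    (hM : ∀ σ ∈ M, Ty.Neg σ) : Good (underFrozen φ) (bind M a) := by
  rintro ⟨x, τ⟩ hp hx
  rcases mem_bind.1 hp with ⟨h0, hp⟩ | ⟨z, hz, hp'⟩
  · exact hM _ hp
  · rcases hx with hx | hx
    · exact absurd (hz.symm.trans hx) (Nat.succ_ne_zero _)
    · exact h.underBinder (M := M) _ hp hx

end Usage

/-- `Multi P M a`: for each member `i` of `M` there is a usage satisfying `P i`, and `a` is the sum
of all of these. -/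
inductive Multi {ι : Type} (P : ι → Usage → Prop) : Multiset ι → Usage → Prop
  | zero : Multi P 0 0
  | cons {i : ι} {M : Multiset ι} {a b : Usage} :
      P i a → Multi P M b → Multi P (i ::ₘ M) (a + b)

namespace Multi

variable {ι κ : Type} {P Q : ι → Usage → Prop} {M N : Multiset ι} {a b : Usage}

theorem eq_zero (h : Multi P 0 a) : a = 0 := by
  generalize hM : (0 : Multiset ι) = M at h
  cases h with
  | zero => rfl
  | cons => exact absurd hM.symm (Multiset.cons_ne_zero)

theorem singleton {i : ι} (h : P i a) : Multi P {i} a := by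
  simpa using cons h zero

theorem of_cons {i : ι} (h : Multi P (i ::ₘ M) a) :
    ∃ b c, a = b + c ∧ P i b ∧ Multi P M c := by
  generalize hN : i ::ₘ M = N at h
  induction h generalizing M with
  | zero => exact absurd hN Multiset.cons_ne_zero
  | @cons j N b c hj hN' ih =>
    rcases Multiset.cons_eq_cons.1 hN with ⟨rfl, rfl⟩ | ⟨-, K, rfl, rfl⟩
    · exact ⟨b, c, rfl, hj, hN'⟩
    · obtain ⟨d, e, rfl, hd, he⟩ := ih rfl
      exact ⟨d, b + e, add_left_comm .., hd, .cons hj he⟩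

theorem of_singleton {i : ι} (h : Multi P {i} a) : P i a := by
  obtain ⟨b, c, rfl, hb, hc⟩ := of_cons (M := 0) h
  rwa [hc.eq_zero, add_zero]

theorem add (hM : Multi P M a) (hN : Multi P N b) : Multi P (M + N) (a + b) := by
  induction hM with
  | zero => simpa using hN
  | cons hi _ ih => rw [Multiset.cons_add, add_assoc]; exact cons hi ih

theorem of_add (h : Multi P (M + N) a) :
    ∃ b c, a = b + c ∧ Multi P M b ∧ Multi P N c := by
  induction M using Multiset.induction_on generalizing a with
  | empty => exact ⟨0, a, by simp, zero, by simpa using h⟩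
  | cons i M ih =>
    rw [Multiset.cons_add] at h
    obtain ⟨b, c, rfl, hb, hc⟩ := of_cons h
    obtain ⟨d, e, rfl, hd, he⟩ := ih hc
    exact ⟨b + d, e, (add_assoc ..).symm, cons hb hd, he⟩

theorem map_hom (g : Usage →+ Usage) (hg : ∀ i a, P i a → Q i (g a)) (h : Multi P M a) :
    Multi Q M (g a) := by
  induction h with
  | zero => rw [map_zero]; exact zero
  | cons hi _ ih => rw [map_add]; exact cons (hg _ _ hi) ih

theorem of_hom (g : Usage →+ Usage) (hg : ∀ i a, P i a → ∃ b, a = g b ∧ Q i b)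
    (h : Multi P M a) : ∃ b, a = g b ∧ Multi Q M b := by
  induction h with
  | zero => exact ⟨0, (map_zero g).symm, zero⟩
  | cons hi _ ih =>
    obtain ⟨b, rfl, hb⟩ := hg _ _ hi
    obtain ⟨c, rfl, hc⟩ := ih
    exact ⟨b + c, (map_add ..).symm, cons hb hc⟩

theorem of_map {f : κ → ι} {M : Multiset κ} (h : Multi P (M.map f) a) :
    Multi (fun k => P (f k)) M a := by
  induction M using Multiset.induction_on generalizing a with
  | empty => rw [Multiset.map_zero] at h; rw [h.eq_zero]; exact zero
  | cons k M ih =>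
    rw [Multiset.map_cons] at h
    obtain ⟨b, c, rfl, hb, hc⟩ := of_cons h
    exact cons hb (ih hc)

theorem to_map {f : κ → ι} {M : Multiset κ} (h : Multi (fun k => P (f k)) M a) :
    Multi P (M.map f) a := by
  induction h with
  | zero => exact zero
  | cons hi _ ih => rw [Multiset.map_cons]; exact cons hi ih

/-- Transport along implications that keep the context, but not the size, of a usage. -/
theorem resize (hg : ∀ i a, P i a → ∃ n, Q i (a.1, n)) (h : Multi P M a) :
    ∃ n, Multi Q M (a.1, n) := by
  induction h with
  | zero => exact ⟨0, zero⟩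
  | cons hi _ ih =>
    obtain ⟨n, hn⟩ := hg _ _ hi
    obtain ⟨m, hm⟩ := ih
    exact ⟨n + m, cons hn hm⟩

theorem forall_mem {φ : Set ℕ} {p : ι → Prop} (h : Multi P M a) (ha : Usage.Good φ a)
    (hp : ∀ i b, P i b → Usage.Good φ b → p i) : ∀ i ∈ M, p i := by
  intro i hi
  obtain ⟨N, rfl⟩ := Multiset.exists_cons_of_mem hi
  obtain ⟨b, _, rfl, hb, _⟩ := of_cons h
  exact hp i b hb (Usage.good_add.1 ha).1

end Multi

/-- `Typ t τ a`: there is a typing derivation of `t : τ` with usage `a`. Only axioms, abstractions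
and applications count in the size, so explicit substitutions can be moved at no cost. An
argument, of an application or of an explicit substitution, is typed once for each member of a
multiset of types, possibly not at all. -/
def Typ : Term → Ty → Usage → Prop
  | .var x, τ, a => a = Usage.occ x {τ}
  | .lam t, τ, a => ∃ M σ b, τ = Ty.arr M σ ∧ Typ t σ (Usage.bind M b) ∧ a = b + (0, 1)
  | .app t u, τ, a =>
    ∃ M b c, Typ t (Ty.arr M τ) b ∧ Multi (Typ u) M c ∧ a = b + c + (0, 1)
  | .es t u, τ, a => ∃ M b c, Typ t τ (Usage.bind M b) ∧ Multi (Typ u) M c ∧ a = b + c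

theorem Typ.rename {t : Term} {τ : Ty} {a : Usage} (f : ℕ → ℕ) (h : Typ t τ a) :
    Typ (t.rename f) τ (Usage.ren f a) := by
  induction t generalizing f τ a with
  | var x => subst h; simp [Typ, Term.rename, Usage.ren, Usage.occ]
  | lam t ih =>
    obtain ⟨M, σ, b, rfl, hb, rfl⟩ := h
    refine ⟨M, σ, Usage.ren f b, rfl, ?_, Usage.ren_add_size ..⟩
    rw [← Usage.ren_liftRen_bind]
    exact ih _ hb
  | app t u iht ihu =>
    obtain ⟨M, b, c, hb, hc, rfl⟩ := h
    exact ⟨M, _, _, iht f hb, hc.map_hom (Usage.ren f) fun _ _ => ihu f,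
      by rw [Usage.ren_add_size, map_add]⟩
  | es t u iht ihu =>
    obtain ⟨M, b, c, hb, hc, rfl⟩ := h
    refine ⟨M, Usage.ren f b, _, ?_, hc.map_hom (Usage.ren f) fun _ _ => ihu f, map_add ..⟩
    rw [← Usage.ren_liftRen_bind]
    exact iht _ hb

theorem Typ.of_rename {t : Term} {τ : Ty} {a : Usage} {f : ℕ → ℕ} (h : Typ (t.rename f) τ a) :
    ∃ b, a = Usage.ren f b ∧ Typ t τ b := by
  induction t generalizing f τ a with
  | var x => exact ⟨Usage.occ x {τ}, by subst h; simp [Usage.ren, Usage.occ], rfl⟩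
  | lam t ih =>
    obtain ⟨M, σ, b, rfl, hb, rfl⟩ := h
    obtain ⟨c, hc, ht⟩ := ih hb
    obtain ⟨N, d, rfl⟩ := Usage.exists_eq_bind c
    rw [Usage.ren_liftRen_bind] at hc
    obtain ⟨rfl, rfl⟩ := Usage.bind_inj hc
    exact ⟨d + (0, 1), (Usage.ren_add_size ..).symm, M, σ, d, rfl, ht, rfl⟩
  | app t u iht ihu =>
    obtain ⟨M, b, c, hb, hc, rfl⟩ := h
    obtain ⟨b, rfl, hb'⟩ := iht hb
    obtain ⟨c, rfl, hc'⟩ := hc.of_hom (Q := Typ u) (Usage.ren f) fun _ _ => ihu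
    exact ⟨b + c + (0, 1), by rw [Usage.ren_add_size, map_add], M, b, c, hb', hc', rfl⟩
  | es t u iht ihu =>
    obtain ⟨M, b, c, hb, hc, rfl⟩ := h
    obtain ⟨b', hb', ht⟩ := iht hb
    obtain ⟨N, d, rfl⟩ := Usage.exists_eq_bind b'
    rw [Usage.ren_liftRen_bind] at hb'
    obtain ⟨rfl, rfl⟩ := Usage.bind_inj hb'
    obtain ⟨c, rfl, hc'⟩ := hc.of_hom (Q := Typ u) (Usage.ren f) fun _ _ => ihu
    exact ⟨d + c, (map_add ..).symm, M, d, c, ht, hc', rfl⟩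

/-! ### Weakly normalizing terms are typable -/

/-- A substitution of variables for themselves is typed by axioms only. -/
theorem Multi.typ_var {Γ : Multiset (ℕ × Ty)} {a : Usage}
    (h : Multi (fun p : ℕ × Ty => Typ (Lam.var p.1).toTerm p.2) Γ a) : a.1 = Γ := by
  induction h with
  | zero => rfl
  | @cons p M b c hp _ ih => rw [Prod.fst_add, ih, hp]; rfl

/-- A derivation for a substituted term, read backwards, splits into one for the term and one for
each use of a variable. -/
theorem Typ.of_subst {t : Lam} {σ : ℕ → Lam} {τ : Ty} {a : Usage}
    (h : Typ (t.subst σ).toTerm τ a) :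
    ∃ b n, Typ t.toTerm τ b ∧ Multi (fun p : ℕ × Ty => Typ (σ p.1).toTerm p.2) b.1 (a.1, n) := by
  induction t generalizing σ τ a with
  | var x => exact ⟨_, a.2, rfl, Multi.singleton h⟩
  | lam t ih =>
    obtain ⟨M, ρ, c, rfl, hc, rfl⟩ := h
    obtain ⟨b, n, hb, hm⟩ := ih hc
    obtain ⟨N, d, rfl⟩ := Usage.exists_eq_bind b
    rw [Usage.bind, Prod.fst_add] at hm
    obtain ⟨e, g, heg, he, hg⟩ := hm.of_add
    have he' : e.1 = N.map (Prod.mk 0) := by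
      refine Multi.typ_var (Multi.to_map ?_)
      exact he.of_map
    obtain ⟨s, rfl, hs⟩ := (Multi.of_map (κ := ℕ × Ty) (f := Prod.map Nat.succ id) hg).of_hom
      (Usage.ren Nat.succ)
      (Q := fun p => Typ (σ p.1).toTerm p.2) fun p a hp => by
        simp only [Prod.map_fst, Prod.map_snd, Lam.liftSub, Lam.toTerm_rename] at hp
        exact hp.of_rename
    have h1 : (Usage.bind M c).1 = (Usage.bind N s).1 := by
      rw [congrArg Prod.fst heg, Prod.fst_add, he']; rfl
    obtain ⟨rfl, h2⟩ := Usage.bind_fst_inj h1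
    refine ⟨d + (0, 1), s.2, ⟨M, ρ, d, rfl, hb, rfl⟩, ?_⟩
    simpa [h2] using hs
  | app t u iht ihu =>
    obtain ⟨M, b, c, hb, hc, rfl⟩ := h
    obtain ⟨b', n, hb', hbm⟩ := iht hb
    have : ∃ c' m, Multi (Typ u.toTerm) M c' ∧
        Multi (fun p : ℕ × Ty => Typ (σ p.1).toTerm p.2) c'.1 (c.1, m) := by
      clear hb hb' hbm
      induction hc with
      | zero => exact ⟨0, 0, .zero, .zero⟩
      | cons hi _ ih =>
        obtain ⟨c₁, m₁, h₁, h₁'⟩ := ihu hi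
        obtain ⟨c₂, m₂, h₂, h₂'⟩ := ih
        exact ⟨_, m₁ + m₂, .cons h₁ h₂, h₁'.add h₂'⟩
    obtain ⟨c', m, hc', hcm⟩ := this
    refine ⟨_, n + m, ⟨M, b', c', hb', hc', rfl⟩, ?_⟩
    simpa using hbm.add hcm

theorem Lam.Beta.typ_expansion {t t' : Lam} (h : Lam.Beta t t') {τ : Ty} {a : Usage}
    (ha : Typ t'.toTerm τ a) : ∃ n, Typ t.toTerm τ (a.1, n) := by
  induction h generalizing τ a with
  | beta t u =>
    obtain ⟨b, n, hb, hm⟩ := Typ.of_subst ha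
    obtain ⟨M, c, rfl⟩ := Usage.exists_eq_bind b
    rw [Usage.bind, Prod.fst_add] at hm
    obtain ⟨d, e, hde, hd, he⟩ := hm.of_add
    have he' : e.1 = c.1 :=
      Multi.typ_var (Multi.of_map (κ := ℕ × Ty) (f := Prod.map Nat.succ id) he)
    have hd' : Multi (Typ u.toTerm) M d := Multi.of_map (f := Prod.mk 0) hd
    refine ⟨c.2 + 1 + d.2 + 1, M, c + (0, 1), d, ⟨M, τ, c, rfl, hb, rfl⟩, hd', ?_⟩
    ext1
    · have := congrArg Prod.fst hde
      simp only [Prod.fst_add, he'] at this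
      simp [this, add_comm]
    · simp
  | lam _ ih =>
    obtain ⟨M, σ, b, rfl, hb, rfl⟩ := ha
    obtain ⟨n, hn⟩ := ih hb
    refine ⟨n + 1, M, σ, (b.1, n), rfl, ?_, by simp⟩
    convert hn using 1
    exact Prod.ext rfl (by rw [Usage.bind_snd])
  | appLeft u _ ih =>
    obtain ⟨M, b, c, hb, hc, rfl⟩ := ha
    obtain ⟨n, hn⟩ := ih hb
    exact ⟨n + c.2 + 1, M, _, c, hn, hc, by ext1 <;> simp⟩
  | @appRight t u u' _ ih =>
    obtain ⟨M, b, c, hb, hc, rfl⟩ := ha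
    obtain ⟨n, hn⟩ := hc.resize (Q := Typ u.toTerm) fun _ _ => ih
    exact ⟨b.2 + n + 1, M, b, _, hb, hn, by ext1 <;> simp⟩

/-- A normal form has a type satisfying `Ty.Pos` in a context satisfying `Ty.Neg`. If it is not an
abstraction, then it has every type satisfying `Ty.Neg`. -/
theorem Lam.exists_typ_of_normal (t : Lam) (hn : ∀ b, ¬ Lam.Beta t b) :
    (∃ τ a, Ty.Pos τ ∧ Usage.Good Set.univ a ∧ Typ t.toTerm τ a) ∧
    ((∀ s, t ≠ .lam s) → ∀ τ, Ty.Neg τ → ∃ a, Usage.Good Set.univ a ∧ Typ t.toTerm τ a) := by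
  induction t with
  | var x =>
    have (τ : Ty) (hτ : Ty.Neg τ) : ∃ a, Usage.Good Set.univ a ∧ Typ (Lam.var x).toTerm τ a :=
      ⟨_, by simpa [Usage.Good, Usage.occ] using hτ, rfl⟩
    exact ⟨⟨_, _, .base, (this _ .base).choose_spec⟩, fun _ => this⟩
  | lam t ih =>
    obtain ⟨⟨τ, a, hτ, ha, ht⟩, -⟩ := ih fun b hb => hn _ hb.lam
    obtain ⟨M, b, rfl⟩ := Usage.exists_eq_bind a
    refine ⟨⟨Ty.arr M τ, b + (0, 1), .arr (fun σ hσ => ?_) hτ, fun p hp _ => ?_,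
      M, τ, b, rfl, ht, rfl⟩, fun h => absurd rfl (h t)⟩
    · exact ha (0, σ) (Usage.mem_bind.2 (.inl ⟨rfl, hσ⟩)) trivial
    · exact ha (p.1 + 1, p.2) (Usage.mem_bind.2 (.inr ⟨_, rfl, by simpa using hp⟩)) trivial
  | app t u iht ihu =>
    have ht : ∀ s, t ≠ .lam s := by rintro s rfl; exact hn _ (.beta s u)
    obtain ⟨-, iht⟩ := iht fun b hb => hn _ (hb.appLeft u)
    obtain ⟨⟨σ, c, hσ, hc, hu⟩, -⟩ := ihu fun b hb => hn _ (hb.appRight t)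
    have (τ : Ty) (hτ : Ty.Neg τ) :
        ∃ a, Usage.Good Set.univ a ∧ Typ (Lam.app t u).toTerm τ a := by
      obtain ⟨b, hb, hbt⟩ := iht ht (Ty.arr {σ} τ) (.arr (by simp) (by simpa using hσ) hτ)
      refine ⟨b + c + (0, 1), ?_, {σ}, b, c, hbt, .singleton hu, rfl⟩
      exact Usage.good_add.2 ⟨Usage.good_add.2 ⟨hb, hc⟩, by simp [Usage.Good]⟩
    exact ⟨⟨_, _, .base, (this _ .base).choose_spec⟩, fun _ => this⟩

theorem Lam.exists_typ_of_weaklyNormalizing {t : Lam} (h : WeaklyNormalizing Lam.Beta t) :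
    ∃ τ a, Ty.Pos τ ∧ Usage.Good Set.univ a ∧ Typ t.toTerm τ a := by
  obtain ⟨n, htn, hn⟩ := h
  induction htn using Relation.ReflTransGen.head_induction_on with
  | refl => exact (n.exists_typ_of_normal hn).1
  | head h _ ih =>
    obtain ⟨τ, a, hτ, ha, ht⟩ := ih
    obtain ⟨m, hm⟩ := h.typ_expansion ht
    exact ⟨τ, (a.1, m), hτ, ha, hm⟩

/-! ### Reduction steps decrease the size of typing derivations -/

theorem Struct.neg {φ : Set ℕ} {t : Term} (h : Struct φ t) {τ : Ty} {a : Usage} (ht : Typ t τ a)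
    (ha : Usage.Good φ a) : Ty.Neg τ := by
  induction h generalizing τ a with
  | @var φ x hx => subst ht; exact ha (x, τ) (by simp [Usage.occ]) hx
  | app u _ ih =>
    obtain ⟨M, b, c, hb, -, rfl⟩ := ht
    exact (ih hb (Usage.good_add.1 (Usage.good_add.1 ha).1).1).of_arr.2.2
  | es u _ ih =>
    obtain ⟨M, b, c, hb, -, rfl⟩ := ht
    exact ih hb (Usage.good_add.1 ha).1.underBinder
  | esStruct _ _ iht ihu =>
    obtain ⟨M, b, c, hb, hc, rfl⟩ := ht
    obtain ⟨hgb, hgc⟩ := Usage.good_add.1 ha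
    exact iht hb (hgb.underFrozen (hc.forall_mem hgc fun _ _ => ihu))

/-- The effect on usages of a step labelled by `ρ`, in a term with usage `a`, where `P` holds of the
usages of the resulting term. Rules dB and lsv keep the context and decrease the size; `id x` shows
that the context gives a type to `x`; `sub x v` removes some axioms for `x`, at least one, and adds
derivations of `v` with the same types. -/
def Rule.Effect : Rule → Usage → (Usage → Prop) → Prop
  | .dB, a, P | .lsv, a, P => ∃ n < a.2, P (a.1, n)
  | .id x, a, _ => ∃ τ, (x, τ) ∈ a.1
  | .sub x v, a, P => ∃ M ≠ 0, ∃ b, a = b + Usage.occ x M ∧ ∀ c, Multi (Typ v) M c → P (b + c)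

namespace Rule.Effect

variable {ρ : Rule} {a b : Usage} {P Q R : Usage → Prop}

/-- A step in one premise of a derivation has the same effect on the whole derivation. -/
theorem add_right (h : ρ.Effect a P) (hQ : ∀ c, P c → Q (c + b)) : ρ.Effect (a + b) Q := by
  cases ρ with
  | dB => obtain ⟨n, hn, h⟩ := h; exact ⟨n + b.2, Nat.add_lt_add_right hn _, hQ _ h⟩
  | lsv => obtain ⟨n, hn, h⟩ := h; exact ⟨n + b.2, Nat.add_lt_add_right hn _, hQ _ h⟩
  | id x => obtain ⟨τ, h⟩ := h; exact ⟨τ, Multiset.mem_add.2 (.inl h)⟩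
  | sub x v =>
    obtain ⟨M, hM, c, rfl, h⟩ := h
    refine ⟨M, hM, c + b, add_right_comm .., fun d hd => ?_⟩
    rw [add_right_comm]
    exact hQ _ (h d hd)

theorem mono (h : ρ.Effect a P) (hQ : ∀ c, P c → Q c) : ρ.Effect a Q := by
  simpa using h.add_right (b := 0) (Q := Q) (by simpa using hQ)

theorem add (ha : ρ.Effect a P) (hb : ρ.Effect b Q) (hR : ∀ c d, P c → Q d → R (c + d)) :
    ρ.Effect (a + b) R := by
  cases ρ with
  | dB =>
    obtain ⟨n, hn, ha⟩ := ha
    obtain ⟨m, hm, hb⟩ := hb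
    exact ⟨n + m, Nat.add_lt_add hn hm, hR _ _ ha hb⟩
  | lsv =>
    obtain ⟨n, hn, ha⟩ := ha
    obtain ⟨m, hm, hb⟩ := hb
    exact ⟨n + m, Nat.add_lt_add hn hm, hR _ _ ha hb⟩
  | id x => obtain ⟨τ, h⟩ := ha; exact ⟨τ, Multiset.mem_add.2 (.inl h)⟩
  | sub x v =>
    obtain ⟨M, hM, c, rfl, ha⟩ := ha
    obtain ⟨N, hN, d, rfl, hb⟩ := hb
    refine ⟨M + N, by simp [hM], c + d, by rw [Usage.occ_add, add_add_add_comm], fun e he => ?_⟩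
    obtain ⟨e₁, e₂, rfl, he₁, he₂⟩ := he.of_add
    rw [add_add_add_comm]
    exact hR _ _ (ha _ he₁) (hb _ he₂)

/-- A step in a term that is typed several times is made in each of its derivations. As there is
at least one, the effect is the one of a single step. The hypothesis `a = b + c` of `hS` says that
`b` is part of the usage `a`. -/
theorem multi {ι : Type} {M : Multiset ι} {S T : ι → Usage → Prop} (h : Multi S M a) (hM : M ≠ 0)
    (hS : ∀ i ∈ M, ∀ b c, a = b + c → S i b → ρ.Effect b (T i)) : ρ.Effect a (Multi T M) := by
  induction h with
  | zero => exact absurd rfl hM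
  | @cons i N b c hi hN ih =>
    have hb := hS i (Multiset.mem_cons_self i N) b c rfl hi
    by_cases hN0 : N = 0
    · subst hN0
      obtain rfl := hN.eq_zero
      rw [add_zero]
      exact hb.mono fun d hd => Multi.singleton hd
    · refine hb.add (ih hN0 fun j hj d e hde => hS j (Multiset.mem_cons_of_mem hj) d (b + e) ?_)
        fun _ _ => .cons
      rw [hde, add_left_comm]

/-- The effect of a step under a binder, seen from outside of it. -/
theorem of_bind {M : Multiset Ty} (h : ρ.shift.Effect (Usage.bind M a) P)
    (hQ : ∀ c, P (Usage.bind M c) → Q c) : ρ.Effect a Q := by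
  have hsize : ∀ n, ((Usage.bind M a).1, n) = Usage.bind M (a.1, n) := fun n =>
    Prod.ext rfl (Usage.bind_snd ..).symm
  cases ρ with
  | dB =>
    obtain ⟨n, hn, h⟩ := h
    exact ⟨n, by rwa [Usage.bind_snd] at hn, hQ _ (hsize n ▸ h)⟩
  | lsv =>
    obtain ⟨n, hn, h⟩ := h
    exact ⟨n, by rwa [Usage.bind_snd] at hn, hQ _ (hsize n ▸ h)⟩
  | id x =>
    obtain ⟨τ, h⟩ := h
    rcases Usage.mem_bind.1 h with ⟨h, -⟩ | ⟨y, hy, h⟩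
    · exact absurd h (Nat.succ_ne_zero _)
    · obtain rfl : x = y := Nat.succ.inj hy
      exact ⟨τ, h⟩
  | sub x v =>
    obtain ⟨N, hN, b, hb, h⟩ := h
    obtain ⟨K, c, rfl⟩ := Usage.exists_eq_bind b
    rw [← Usage.bind_add_occ] at hb
    obtain ⟨rfl, rfl⟩ := Usage.bind_inj hb
    refine ⟨N, hN, c, rfl, fun d hd => hQ _ ?_⟩
    have := h _ (hd.map_hom (Usage.ren Nat.succ) fun _ _ => Typ.rename _)
    rwa [← Usage.bind_zero, ← Usage.bind_add, add_zero] at this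

end Rule.Effect

theorem AuxDB.effect {t t' : Term} (h : AuxDB t t') {τ : Ty} {a : Usage} (ht : Typ t τ a) :
    Rule.dB.Effect a (Typ t' τ) := by
  induction h generalizing τ a with
  | base t u =>
    obtain ⟨M, b, c, ⟨N, σ, d, hN, hd, rfl⟩, hc, rfl⟩ := ht
    obtain ⟨rfl, rfl⟩ := Ty.arr_inj hN
    exact ⟨d.2 + c.2, by simp, M, d, c, hd, hc, by ext1 <;> simp⟩
  | @sigma t u z w _ ih =>
    obtain ⟨M, b, c, ⟨N, d, e, hd, he, rfl⟩, hc, rfl⟩ := ht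
    have hu := hc.map_hom (Q := Typ u.shift) (Usage.ren Nat.succ) fun _ _ => Typ.rename _
    have h := ih ⟨M, _, _, hd, hu, rfl⟩
    rw [← Usage.bind_zero, ← Usage.bind_add, add_zero, ← Usage.bind_add_size] at h
    have h' : Rule.dB.Effect (d + c + (0, 1)) fun f => Typ z τ (Usage.bind N f) :=
      Rule.Effect.of_bind (ρ := .dB) h fun _ h => h
    rw [show d + e + c + (0, 1) = d + c + (0, 1) + e by abel]
    exact h'.add_right fun f hf => ⟨N, f, e, hf, he, rfl⟩

/-- A derivation of `u[y\w]` with several types consists of derivations of `u` and of `w`. -/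
theorem Multi.of_es {u w : Term} {M : Multiset Ty} {a : Usage} (h : Multi (Typ (es u w)) M a) :
    ∃ N b c, Multi (Typ u) M (Usage.bind N b) ∧ Multi (Typ w) N c ∧ a = b + c := by
  induction h with
  | zero =>
    exact ⟨0, 0, 0, by rw [Usage.bind_zero, map_zero]; exact .zero, .zero, (add_zero _).symm⟩
  | cons hi _ ih =>
    obtain ⟨N₁, b₁, c₁, hb₁, hc₁, rfl⟩ := hi
    obtain ⟨N₂, b₂, c₂, hb₂, hc₂, rfl⟩ := ih
    refine ⟨N₁ + N₂, b₁ + b₂, c₁ + c₂, ?_, hc₁.add hc₂, add_add_add_comm ..⟩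
    rw [Usage.bind_add]
    exact .cons hb₁ hb₂

/-- In a derivation of `t[x\u[y\w]]` the substitution `[y\w]` can be moved outwards, at no cost. -/
theorem Typ.es_comm {t u w : Term} {τ : Ty} {a : Usage} (h : Typ (es t (es u w)) τ a) :
    ∃ N b c, Typ (es (t.rename (liftRen Nat.succ)) u) τ (Usage.bind N b) ∧
      Multi (Typ w) N c ∧ a = b + c := by
  obtain ⟨M, b, c, hb, hc, rfl⟩ := h
  obtain ⟨N, d, e, hd, he, rfl⟩ := hc.of_es
  refine ⟨N, b + d, e, ⟨M, Usage.ren Nat.succ b, _, ?_, hd, ?_⟩, he, (add_assoc ..).symm⟩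
  · rw [← Usage.ren_liftRen_bind]
    exact hb.rename _
  · rw [← Usage.bind_zero, ← Usage.bind_add, zero_add]

mutual

/-- A step has its intended effect on the usage of every derivation whose types, for the frozen
variables and, at a top-level-like position, for the term itself, have the right polarity. -/
theorem Step.effect {ρ : Rule} {φ : Set ℕ} {μ : PosFlag} {t t' : Term} {τ : Ty} {a : Usage} :
    Step ρ φ μ t t' → Typ t τ a → Usage.Good φ a → (μ = .top → Ty.Pos τ) → ρ.Effect a (Typ t' τ)
  | .appLeft _ h, ⟨M, b, c, hb, hc, hbc⟩, ha, _ => by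
    subst hbc
    rw [Usage.good_add, Usage.good_add] at ha
    rw [add_assoc]
    refine (h.effect hb ha.1.1 fun h => by cases h).add_right fun d hd => ?_
    exact ⟨M, d, c, hd, hc, (add_assoc ..).symm⟩
  | .appRight (u' := u') hs h, ⟨M, b, c, hb, hc, hbc⟩, ha, _ => by
    subst hbc
    rw [Usage.good_add, Usage.good_add] at ha
    -- The argument of a structure is typed, and at a type of positive polarity.
    obtain ⟨hM, hpos, -⟩ := (hs.neg hb ha.1.1).of_arr
    rw [show b + c + (0, 1) = c + (b + (0, 1)) by abel]
    refine (Rule.Effect.multi (T := Typ u') hc hM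
      fun σ hσ d e hde hd => ?_).add_right fun d hd => ?_
    · exact h.effect hd (Usage.good_add.1 (hde ▸ ha.1.2)).1 fun _ => hpos σ hσ
    · exact ⟨M, b, d, hb, hd, by abel⟩
  | .absTop h, ⟨M, σ, b, hτ, hb, hbc⟩, ha, hpos => by
    subst hbc hτ
    obtain ⟨hM, hσ⟩ := (hpos rfl).of_arr
    refine Rule.Effect.add_right (b := (0, 1)) (P := fun c => Typ _ σ (Usage.bind M c))
      (.of_bind (h.effect hb ((Usage.good_add.1 ha).1.underFrozen hM) fun _ => hσ) fun _ h => h)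
      fun c hc => ⟨M, σ, c, rfl, hc, rfl⟩
  | .absBot h, ⟨M, σ, b, hτ, hb, hbc⟩, ha, _ => by
    subst hbc hτ
    refine Rule.Effect.add_right (b := (0, 1)) (P := fun c => Typ _ σ (Usage.bind M c))
      (.of_bind (h.effect hb (Usage.good_add.1 ha).1.underBinder fun h => by cases h) fun _ h => h)
      fun c hc => ⟨M, σ, c, rfl, hc, rfl⟩
  | .esLeft _ h, ⟨M, b, c, hb, hc, hbc⟩, ha, hpos => by
    subst hbc
    refine Rule.Effect.add_right (P := fun c => Typ _ τ (Usage.bind M c))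
      (.of_bind (h.effect hb (Usage.good_add.1 ha).1.underBinder hpos) fun _ h => h)
      fun d hd => ⟨M, d, c, hd, hc, rfl⟩
  | .esLeftStruct h hs, ⟨M, b, c, hb, hc, hbc⟩, ha, hpos => by
    subst hbc
    rw [Usage.good_add] at ha
    have hM := hc.forall_mem ha.2 fun _ _ => hs.neg
    refine Rule.Effect.add_right (P := fun c => Typ _ τ (Usage.bind M c))
      (.of_bind (h.effect hb (ha.1.underFrozen hM) hpos) fun _ h => h)
      fun d hd => ⟨M, d, c, hd, hc, rfl⟩
  | .esRight (u' := u') hid h, ⟨M, b, c, hb, hc, hbc⟩, ha, hpos => by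
    subst hbc
    rw [Usage.good_add] at ha
    -- The body has a typed occurrence of the bound variable, so `u` is typed at least once.
    have hM : M ≠ 0 := by
      obtain ⟨σ, hσ⟩ := hid.effect hb ha.1.underBinder hpos
      rcases Usage.mem_bind.1 hσ with ⟨-, hσ⟩ | ⟨x, hx, -⟩
      · rintro rfl; simp at hσ
      · exact absurd hx.symm (Nat.succ_ne_zero x)
    rw [add_comm]
    refine (Rule.Effect.multi (T := Typ u') hc hM
      fun σ hσ d e hde hd => ?_).add_right fun d hd => ?_
    · exact h.effect hd (Usage.good_add.1 (hde ▸ ha.2)).1 fun h => by cases h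
    · exact ⟨M, b, d, hb, hd, add_comm ..⟩
  | .id _ _ x, ht, _, _ => ⟨τ, by rw [ht]; simp [Usage.occ]⟩
  | .sub _ _ x v, ht, _, _ =>
    ⟨{τ}, by simp, 0, by rw [zero_add]; exact ht, fun c hc => by
      rw [zero_add]; exact hc.of_singleton⟩
  | .dB h, ht, _, _ => h.effect ht
  | .lsv h, ht, ha, hpos => h.effect ht ha hpos

theorem AuxLSV.effect {φ : Set ℕ} {μ : PosFlag} {t t' : Term} {τ : Ty} {a : Usage} :
    AuxLSV φ μ t t' → Typ t τ a → Usage.Good φ a → (μ = .top → Ty.Pos τ) →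
      Rule.lsv.Effect a (Typ t' τ)
  | .base h _, ⟨M, b, c, hb, hc, hbc⟩, ha, hpos => by
    subst hbc
    obtain ⟨N, hN, d, hbd, hd⟩ := h.effect hb (Usage.good_add.1 ha).1.underBinder hpos
    obtain ⟨K, e, rfl⟩ := Usage.exists_eq_bind d
    have hbd' : Usage.bind M b = Usage.bind (K + N) (e + (0, N.card)) := by
      rw [hbd, Usage.bind_add_occ_zero]
    obtain ⟨rfl, rfl⟩ := Usage.bind_inj hbd'
    obtain ⟨c₁, c₂, rfl, hc₁, hc₂⟩ := hc.of_add
    have ht := hd _ (hc₂.map_hom (Usage.ren Nat.succ) fun _ _ => Typ.rename _)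
    rw [← Usage.bind_zero, ← Usage.bind_add, add_zero] at ht
    refine ⟨(e + c₂ + c₁).2, ?_, K, e + c₂, c₁, ht, hc₁, ?_⟩
    · have := Multiset.card_pos.2 hN
      simp; omega
    · ext1
      · simp [add_comm, add_left_comm]
      · rfl
  | .sigma w h, ht, ha, hpos => by
    obtain ⟨N, b, c, hb, hc, rfl⟩ := ht.es_comm
    have h' := h.effect hb (Usage.good_add.1 ha).1.underBinder hpos
    refine Rule.Effect.add_right (P := fun c => Typ _ τ (Usage.bind N c))
      (.of_bind (ρ := .lsv) h' fun _ h => h) fun d hd => ⟨N, d, c, hd, hc, rfl⟩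
  | .sigmaStruct h hs, ht, ha, hpos => by
    obtain ⟨N, b, c, hb, hc, rfl⟩ := ht.es_comm
    rw [Usage.good_add] at ha
    have hN := hc.forall_mem ha.2 fun _ _ => hs.neg
    have h' := h.effect hb (ha.1.underFrozen hN) hpos
    refine Rule.Effect.add_right (P := fun c => Typ _ τ (Usage.bind N c))
      (.of_bind (ρ := .lsv) h' fun _ h => h) fun d hd => ⟨N, d, c, hd, hc, rfl⟩

end

theorem Typ.stronglyNormalizing {t : Term} {τ : Ty} {a : Usage} (hτ : Ty.Pos τ)
    (ha : Usage.Good Set.univ a) (ht : Typ t τ a) : StronglyNormalizing SnRed t := by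
  obtain ⟨Γ, n⟩ := a
  induction n using Nat.strong_induction_on generalizing t with
  | _ n ih =>
    refine Acc.intro t fun t' ⟨φ, _, h⟩ => ?_
    have hφ : Usage.Good φ (Γ, n) := fun p hp _ => ha p hp trivial
    obtain ⟨m, hm, ht'⟩ : ∃ m < n, Typ t' τ (Γ, m) := by
      rcases h with h | h <;> exact h.effect ht hφ fun _ => hτ
    exact ih m hm ha ht'

/-! ### Normal forms -/

/-- `NF ne φ t`: the pure term `t` is a β-normal form whose free variables are in `φ`, and it is
not an abstraction if `ne` is `true`. -/
inductive Lam.NF : Bool → Set ℕ → Lam → Prop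
  | var {φ : Set ℕ} {x : ℕ} : x ∈ φ → NF true φ (.var x)
  | app {φ : Set ℕ} {t u : Lam} : NF true φ t → NF false φ u → NF true φ (.app t u)
  | lam {φ : Set ℕ} {t : Lam} : NF false (underFrozen φ) t → NF false φ (.lam t)
  | ofNeutral {φ : Set ℕ} {t : Lam} : NF true φ t → NF false φ t

namespace Lam.NF

theorem not_beta {ne : Bool} {φ : Set ℕ} {t : Lam} (h : NF ne φ t) (b : Lam) : ¬ Beta t b := by
  induction h generalizing b with
  | var _ => intro h; cases h
  | app ht _ iht ihu =>
    intro h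
    cases h with
    | beta => cases ht
    | appLeft _ h => exact iht _ h
    | appRight _ h => exact ihu _ h
  | lam _ ih =>
    intro h
    cases h with
    | lam h => exact ih _ h
  | ofNeutral _ ih => exact ih b

theorem rename {ne : Bool} {φ ψ : Set ℕ} {t : Lam} {f : ℕ → ℕ} (h : NF ne φ t)
    (hf : ∀ x ∈ φ, f x ∈ ψ) : NF ne ψ (t.rename f) := by
  induction h generalizing f ψ with
  | var hx => exact .var (hf _ hx)
  | app _ _ iht ihu => exact .app (iht hf) (ihu hf)
  | lam _ ih =>
    refine .lam (ih ?_)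
    rintro _ (rfl | ⟨x, hx, rfl⟩)
    · exact .inl rfl
    · exact .inr ⟨_, hf x hx, rfl⟩
  | ofNeutral _ ih => exact .ofNeutral (ih hf)

/-- Substituting neutral normal forms for variables creates no redex. -/
theorem subst {ne : Bool} {φ ψ : Set ℕ} {t : Lam} {σ : ℕ → Lam} (h : NF ne φ t)
    (hσ : ∀ x ∈ φ, NF true ψ (σ x)) : NF ne ψ (t.subst σ) := by
  induction h generalizing σ ψ with
  | var hx => exact hσ _ hx
  | app _ _ iht ihu => exact .app (iht hσ) (ihu hσ)
  | lam _ ih =>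
    refine .lam (ih ?_)
    rintro _ (rfl | ⟨x, hx, rfl⟩)
    · exact .var (.inl rfl)
    · exact (hσ x hx).rename fun y hy => .inr ⟨y, hy, rfl⟩
  | ofNeutral _ ih => exact .ofNeutral (ih hσ)

theorem inst_of_underBinder {ne : Bool} {φ : Set ℕ} {t : Lam} (h : NF ne (underBinder φ) t)
    (u : Lam) : NF ne φ (t.inst u) :=
  h.subst fun _ ⟨_, hy, hx⟩ => hx ▸ .var hy

theorem inst_of_underFrozen {ne : Bool} {φ : Set ℕ} {t u : Lam} (h : NF ne (underFrozen φ) t)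
    (hu : NF true φ u) : NF ne φ (t.inst u) :=
  h.subst fun _ hx => hx.elim (fun hx => hx ▸ hu) fun ⟨_, hy, hx⟩ => hx ▸ .var hy

end Lam.NF

theorem image_liftRen_underBinder {f : ℕ → ℕ} {φ ψ : Set ℕ} (hf : ∀ x ∈ φ, f x ∈ ψ) :
    ∀ x ∈ underBinder φ, liftRen f x ∈ underBinder ψ := by
  rintro _ ⟨x, hx, rfl⟩
  exact ⟨f x, hf x hx, rfl⟩

theorem image_liftRen_underFrozen {f : ℕ → ℕ} {φ ψ : Set ℕ} (hf : ∀ x ∈ φ, f x ∈ ψ) :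
    ∀ x ∈ underFrozen φ, liftRen f x ∈ underFrozen ψ := by
  rintro _ (rfl | hx)
  · exact .inl rfl
  · exact .inr (image_liftRen_underBinder hf _ hx)

theorem Struct.rename {φ ψ : Set ℕ} {t : Term} {f : ℕ → ℕ} (h : Struct φ t)
    (hf : ∀ x ∈ φ, f x ∈ ψ) : Struct ψ (t.rename f) := by
  induction h generalizing f ψ with
  | var hx => exact .var (hf _ hx)
  | app u _ ih => exact .app _ (ih hf)
  | es u _ ih => exact .es _ (ih (image_liftRen_underBinder hf))
  | esStruct _ _ iht ihu => exact .esStruct (iht (image_liftRen_underFrozen hf)) (ihu hf)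

/-- Reachable occurrences of a variable stay reachable under renaming. -/
theorem Step.rename_id {ρ : Rule} {x : ℕ} {φ ψ : Set ℕ} {μ : PosFlag} {t t' : Term} {f : ℕ → ℕ}
    (h : Step ρ φ μ t t') (hρ : ρ = .id x) (hf : ∀ y ∈ φ, f y ∈ ψ) :
    Step (.id (f x)) ψ μ (t.rename f) (t.rename f) :=
  match h with
  | .appLeft _ h => .appLeft _ (h.rename_id hρ hf)
  | .appRight hs h => .appRight (hs.rename hf) (h.rename_id hρ hf)
  | .absTop h => .absTop (h.rename_id (x := x + 1) (f := liftRen f) (hρ ▸ rfl)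
      (image_liftRen_underFrozen hf))
  | .absBot h => .absBot (h.rename_id (x := x + 1) (f := liftRen f) (hρ ▸ rfl)
      (image_liftRen_underBinder hf))
  | .esLeft _ h => .esLeft _ (h.rename_id (x := x + 1) (f := liftRen f) (hρ ▸ rfl)
      (image_liftRen_underBinder hf))
  | .esLeftStruct h hs => .esLeftStruct (h.rename_id (x := x + 1) (f := liftRen f) (hρ ▸ rfl)
      (image_liftRen_underFrozen hf)) (hs.rename hf)
  | .esRight h₁ h₂ => .esRight (h₁.rename_id (x := 0) (f := liftRen f) rfl
      (image_liftRen_underBinder hf)) (h₂.rename_id hρ hf)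
  | .id _ _ y => by
    obtain rfl := Rule.id.inj hρ
    exact .id ..
  | .sub _ _ _ _ => by cases hρ
  | .dB _ => by cases hρ
  | .lsv _ => by cases hρ

/-- A reachable occurrence of a variable can be replaced. -/
theorem Step.exists_sub_of_id {ρ : Rule} {x : ℕ} {φ : Set ℕ} {μ : PosFlag} {t t' : Term}
    (h : Step ρ φ μ t t') (hρ : ρ = .id x) (v : Term) : ∃ t'', Step (.sub x v) φ μ t t'' :=
  match h with
  | .appLeft _ h => (h.exists_sub_of_id hρ v).imp' _ fun _ => .appLeft _
  | .appRight hs h => (h.exists_sub_of_id hρ v).imp' _ fun _ => .appRight hs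
  | .absTop h => (h.exists_sub_of_id (x := x + 1) (hρ ▸ rfl) v.shift).imp' _ fun _ => .absTop
  | .absBot h => (h.exists_sub_of_id (x := x + 1) (hρ ▸ rfl) v.shift).imp' _ fun _ => .absBot
  | .esLeft _ h => (h.exists_sub_of_id (x := x + 1) (hρ ▸ rfl) v.shift).imp' _ fun _ => .esLeft _
  | .esLeftStruct h hs =>
    (h.exists_sub_of_id (x := x + 1) (hρ ▸ rfl) v.shift).imp' _ fun _ h => .esLeftStruct h hs
  | .esRight h₁ h₂ => (h₂.exists_sub_of_id hρ v).imp' _ fun _ => .esRight h₁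
  | .id _ _ y => by
    obtain rfl := Rule.id.inj hρ
    exact ⟨v, .sub ..⟩
  | .sub _ _ _ _ => by cases hρ
  | .dB _ => by cases hρ
  | .lsv _ => by cases hρ

theorem Step.mem_fv_of_id {ρ : Rule} {x : ℕ} {φ : Set ℕ} {μ : PosFlag} {t t' : Term}
    (h : Step ρ φ μ t t') (hρ : ρ = .id x) : x ∈ t.fv :=
  match h with
  | .appLeft _ h => .inl (h.mem_fv_of_id hρ)
  | .appRight _ h => .inr (h.mem_fv_of_id hρ)
  | .absTop h => h.mem_fv_of_id (x := x + 1) (hρ ▸ rfl)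
  | .absBot h => h.mem_fv_of_id (x := x + 1) (hρ ▸ rfl)
  | .esLeft _ h => .inl (h.mem_fv_of_id (x := x + 1) (hρ ▸ rfl))
  | .esLeftStruct h _ => .inl (h.mem_fv_of_id (x := x + 1) (hρ ▸ rfl))
  | .esRight _ h => .inr (h.mem_fv_of_id hρ)
  | .id _ _ y => by
    obtain rfl := Rule.id.inj hρ
    exact rfl
  | .sub _ _ _ _ => by cases hρ
  | .dB _ => by cases hρ
  | .lsv _ => by cases hρ

/-- An answer: an abstraction under a list of explicit substitutions. -/
inductive Answer : Term → Prop
  | lam (t : Term) : Answer (lam t)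
  | es {t : Term} (u : Term) : Answer t → Answer (Term.es t u)

theorem Answer.rename {t : Term} (h : Answer t) (f : ℕ → ℕ) : Answer (t.rename f) := by
  induction h generalizing f with
  | lam t => exact .lam _
  | es u _ ih => exact .es _ (ih _)

theorem Answer.exists_auxDB {t : Term} (h : Answer t) (u : Term) : ∃ z, AuxDB (app t u) z := by
  induction h generalizing u with
  | lam t => exact ⟨_, .base t u⟩
  | es w _ ih => exact (ih u.shift).imp' _ fun _ => .sigma w

theorem Answer.exists_auxLSV {t u : Term} {φ : Set ℕ} {μ : PosFlag} (hu : Answer u)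
    (ht : Step (.id 0) (underBinder φ) μ t t) : ∃ z, AuxLSV φ μ (.es t u) z := by
  induction hu generalizing t φ with
  | lam s => exact (ht.exists_sub_of_id rfl _).imp' _ fun _ h => .base h (.lam s)
  | es w _ ih =>
    refine (ih (ht.rename_id (f := liftRen Nat.succ) rfl ?_)).imp' _ fun _ => .sigma w
    exact image_liftRen_underBinder fun x hx => ⟨x, hx, rfl⟩

/-- The term can make a step by rule dB or lsv. -/
def Reducible (φ : Set ℕ) (μ : PosFlag) (t : Term) : Prop :=
  ∃ ρ t', (ρ = .dB ∨ ρ = .lsv) ∧ Step ρ φ μ t t'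

/-- The term has a reachable occurrence of a variable that is not frozen. -/
def Stuck (φ : Set ℕ) (μ : PosFlag) (t : Term) : Prop :=
  ∃ x ∉ φ, Step (.id x) φ μ t t

/-- The term is a structure that unfolds to a neutral normal form. -/
def NormalStruct (φ : Set ℕ) (t : Term) : Prop :=
  Struct φ t ∧ Lam.NF true φ t.unfold

/-- What a term that is irreducible and not stuck looks like. -/
def Final (φ : Set ℕ) : PosFlag → Term → Prop
  | .bot, t => Answer t ∨ NormalStruct φ t
  | .top, t => Lam.NF false φ t.unfold

/-- `Reducible` is compatible with every context in which both rules are. -/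
theorem Reducible.map {φ ψ : Set ℕ} {μ ν : PosFlag} {t s : Term} {C : Term → Term}
    (hC : ∀ ρ : Rule, ρ.shift = ρ → ∀ t', Step ρ φ μ t t' → Step ρ ψ ν s (C t'))
    (h : Reducible φ μ t) : Reducible ψ ν s := by
  obtain ⟨ρ, t', hρ, ht⟩ := h
  exact ⟨ρ, C t', hρ, hC ρ (by rcases hρ with rfl | rfl <;> rfl) t' ht⟩

theorem NormalStruct.final {φ : Set ℕ} {t : Term} (h : NormalStruct φ t) :
    ∀ μ, Final φ μ t
  | .bot => .inr h
  | .top => .ofNeutral h.2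

/-- Every term is reducible, stuck or final. -/
theorem Term.progress (t : Term) (φ : Set ℕ) (μ : PosFlag) :
    Reducible φ μ t ∨ Stuck φ μ t ∨ Final φ μ t := by
  induction t generalizing φ μ with
  | var x =>
    by_cases hx : x ∈ φ
    · exact .inr (.inr (NormalStruct.final ⟨.var hx, .var hx⟩ μ))
    · exact .inr (.inl ⟨x, hx, .id ..⟩)
  | lam t ih =>
    cases μ with
    | bot => exact .inr (.inr (.inl (.lam t)))
    | top =>
      rcases ih (underFrozen φ) .top with h | ⟨x, hx, h⟩ | h
      · exact .inl (h.map (C := .lam) fun ρ hρ _ h => .absTop (hρ.symm ▸ h))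
      · cases x with
        | zero => exact absurd (.inl rfl) hx
        | succ y => exact .inr (.inl ⟨y, fun hy => hx (.inr ⟨y, hy, rfl⟩), .absTop h⟩)
      · exact .inr (.inr (.lam h))
  | app t u iht ihu =>
    rcases iht φ .bot with h | ⟨x, hx, h⟩ | h | ⟨hs, hn⟩
    · exact .inl (h.map (C := fun t' => .app t' u) fun _ _ _ => .appLeft u)
    · exact .inr (.inl ⟨x, hx, .appLeft u h⟩)
    · obtain ⟨z, hz⟩ := h.exists_auxDB u
      exact .inl ⟨.dB, z, .inl rfl, .dB hz⟩
    · rcases ihu φ .top with h | ⟨x, hx, h⟩ | h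
      · exact .inl (h.map (C := .app t) fun _ _ _ => .appRight hs)
      · exact .inr (.inl ⟨x, hx, .appRight hs h⟩)
      · exact .inr (.inr (NormalStruct.final ⟨.app u hs, .app hn h⟩ μ))
  | es t u iht ihu =>
    rcases iht (underBinder φ) μ with h | ⟨x, hx, h⟩ | h
    · exact .inl (h.map (C := fun t' => .es t' u) fun ρ hρ _ h => .esLeft u (hρ.symm ▸ h))
    · cases x with
      | succ y => exact .inr (.inl ⟨y, fun hy => hx ⟨y, hy, rfl⟩, .esLeft u h⟩)
      | zero =>
        rcases ihu φ .bot with h' | ⟨y, hy, h'⟩ | h' | ⟨hs, hn⟩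
        · exact .inl (h'.map (C := .es t) fun _ _ _ => .esRight h)
        · exact .inr (.inl ⟨y, hy, .esRight h h'⟩)
        · obtain ⟨z, hz⟩ := h'.exists_auxLSV h
          exact .inl ⟨.lsv, z, .inr rfl, .lsv hz⟩
        · -- As `u` is a structure, the bound variable can be frozen in `t`.
          rcases iht (underFrozen φ) μ with h | ⟨x, hx, h⟩ | h
          · exact .inl (h.map (C := fun t' => .es t' u) fun ρ hρ _ h =>
              .esLeftStruct (hρ.symm ▸ h) hs)
          · cases x with
            | zero => exact absurd (.inl rfl) hx
            | succ y =>
              exact .inr (.inl ⟨y, fun hy => hx (.inr ⟨y, hy, rfl⟩), .esLeftStruct h hs⟩)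
          · refine .inr (.inr ?_)
            cases μ with
            | top => exact Lam.NF.inst_of_underFrozen h hn
            | bot =>
              rcases h with h | ⟨hs', hn'⟩
              · exact .inl (.es u h)
              · exact .inr ⟨.esStruct hs' hs, hn'.inst_of_underFrozen hn⟩
    · refine .inr (.inr ?_)
      cases μ with
      | top => exact Lam.NF.inst_of_underBinder h _
      | bot =>
        rcases h with h | ⟨hs', hn'⟩
        · exact .inl (.es u h)
        · exact .inr ⟨.es u hs', hn'.inst_of_underBinder _⟩

/-- The free variables of a term are frozen at top level, so an irreducible term is not stuck. -/
theorem SnRed.unfold_normal {n : Term} (hn : ∀ b, ¬ SnRed n b) (b : Lam) :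
    ¬ Lam.Beta n.unfold b := by
  rcases n.progress n.fv .top with ⟨ρ, t', rfl | rfl, h⟩ | ⟨x, hx, h⟩ | h
  · exact absurd ⟨_, subset_rfl, .inl h⟩ (hn t')
  · exact absurd ⟨_, subset_rfl, .inr h⟩ (hn t')
  · exact absurd (h.mem_fv_of_id rfl) hx
  · exact Lam.NF.not_beta h b

/-! ### Completeness -/

theorem mainTheorem1 (t : Lam) (ht : WeaklyNormalizing Lam.Beta t) :
    StronglyNormalizing SnRed t.toTerm ∧
    ∀ nβ : Lam, IsNormalFormOf Lam.Beta t nβ →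
      ∀ n : Term, IsNormalFormOf SnRed t.toTerm n → n.unfold = nβ := by
  obtain ⟨τ, a, hτ, ha, hta⟩ := Lam.exists_typ_of_weaklyNormalizing ht
  refine ⟨hta.stronglyNormalizing hτ ha, fun nβ ⟨htn, hnβ⟩ n ⟨hn, hnn⟩ => ?_⟩
  have hpar : Relation.ReflTransGen Lam.Par t.toTerm.unfold n.unfold :=
    hn.lift unfold fun _ _ => SnRed.par_unfold
  rw [Lam.unfold_toTerm] at hpar
  exact Lam.eq_of_par_normal hpar (htn.lift (fun s => s) fun _ _ => Lam.Beta.par)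
    (SnRed.unfold_normal hnn) hnβ
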